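/- For a subset $X$ of a group $G$, let $X^+$ denote the subsemigroup of $G$ generated by $X$, that is, the set of all products of one or more elements of $X$. A \emph{semigroup basis} of a finitely generated group $G$ is a subset $X \subseteq G$ with $X^+ = G$ that has the minimum number of elements among all subsets $Y \subseteq G$ with $Y^+ = G$. For $n \geq 0$, let $F_n$ be the free group on $n$ free generators. It is decidable whether a given finite subset of $F_n$ is a semigroup basis of $F_n$. More precisely, there is an algorithm, uniform in $n$, which takes as input a natural number $n$ and a finite list of words (not necessarily reduced) over the letters $x_i$ and $x_i^{-1}$, $i \in \mathbb{N}$, and decides whether all the words use only letters $x_i^{\pm 1}$ with $0 \leq i < n$ and the set of the elements that they represent in $F_n$, the free group on $x_0, \dots, x_{n-1}$, is a semigroup basis of $F_n$. -/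

import Mathlib

/-- `X` is a semigroup basis of the semigroup `S`: `X` generates `S` as a semigroup (by nonempty
products of elements of `X`), and no generating set of `S` has fewer elements. -/
def IsSemigroupBasis {S : Type*} [Semigroup S] (X : Set S) : Prop :=
  Subsemigroup.closure X = ⊤ ∧
    ∀ Y : Set S, Subsemigroup.closure Y = ⊤ → X.encard ≤ Y.encard

/-- The finite subset of the free group on `n` letters whose elements are represented by the words
in the list `L`. A letter `(i, true)` is the `i`-th free generator, `(i, false)` its inverse; words
need not be reduced, and distinct words may represent the same element. -/
def finiteSubsetOf {n : ℕ} (L : List (List (Fin n × Bool))) : Set (FreeGroup (Fin n)) :=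
  {g | ∃ w ∈ L, FreeGroup.mk w = g}

/-- A list of words over the `n` free generators and their inverses, written as plain input data,
with each generator replaced by its index. -/
def inputOf {n : ℕ} (L : List (List (Fin n × Bool))) : List (List (ℕ × Bool)) :=
  L.map fun w => w.map fun x => ((x.1 : ℕ), x.2)

/-!
A subset `X` of `F_n` is a semigroup basis exactly when it has `n + 1` elements and generates `F_n`
as a monoid (`isSemigroupBasis_iff`). The free generators together with the inverse of their product
generate `F_n` as a semigroup, so `n + 1` elements suffice. Fewer do not suffice: the exponent
vectors of at most `n` generating elements would form a basis of `ℚⁿ` of which every vector is a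
nonnegative combination (`lt_encard_of_closure_eq_top`).

The number of elements represented by a list of words is found by free reduction. To decide whether
they generate `F_n` as a monoid, it is enough to decide for each letter whether it lies in the
submonoid, and this is done by Benois' saturation of the automaton that reads the given words in a
loop. Its states are the suffixes of the words. Let `NullPath` be the least relation on states that
contains the pairs joined by empty moves, is reflexive and transitive, and relates `a s` to `t`
whenever it relates `s` to `a⁻¹ t`. It consists of pairs joined by a path with trivial label, and a
letter `a` lies in the submonoid if and only if there is a state `s` such that `NullPath` leads from
`[]` to `a s` and from `s` to `[]` (`mk_singleton_mem_iff`). Since the set of states is finite, the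
least saturated relation can be replaced by a bounded quantification over all saturated relations,
coded by numbers (`mk_singleton_mem_iff_forall_code`), which makes the condition primitive
recursive.
-/

/-! ### Generating a group as a semigroup -/

theorem Submonoid.eq_one_or_mem_subsemigroupClosure {M : Type*} [Monoid M] {X : Set M} {g : M}
    (hg : g ∈ Submonoid.closure X) : g = 1 ∨ g ∈ Subsemigroup.closure X := by
  induction hg using Submonoid.closure_induction with
  | mem x hx => exact Or.inr (Subsemigroup.subset_closure hx)
  | one => exact Or.inl rfl
  | mul x y _ _ hx hy =>
    rcases hx with rfl | hx
    · simpa using hy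
    · rcases hy with rfl | hy
      · simpa using Or.inr hx
      · exact Or.inr (mul_mem hx hy)

theorem Submonoid.mem_closure_of_mem_subsemigroupClosure {M : Type*} [Monoid M] {X : Set M} {g : M}
    (hg : g ∈ Subsemigroup.closure X) : g ∈ Submonoid.closure X := by
  induction hg using Subsemigroup.closure_induction with
  | mem x hx => exact Submonoid.subset_closure hx
  | mul x y _ _ hx hy => exact mul_mem hx hy

/-- The identity costs nothing in a group: if `x ∈ X` and `x⁻¹` is a product of elements of `X`,
then so is `1 = x * x⁻¹`. -/
theorem subsemigroupClosure_eq_top_iff {G : Type*} [Group G] {X : Set G} :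
    Subsemigroup.closure X = ⊤ ↔ X.Nonempty ∧ Submonoid.closure X = ⊤ := by
  constructor
  · intro h
    refine ⟨?_, eq_top_iff.2 fun g _ => ?_⟩
    · by_contra hX
      rw [Set.not_nonempty_iff_eq_empty] at hX
      subst hX
      have h1 : (1 : G) ∈ Subsemigroup.closure (∅ : Set G) := h ▸ Subsemigroup.mem_top _
      rw [Subsemigroup.closure_empty] at h1
      exact Subsemigroup.notMem_bot h1
    · exact Submonoid.mem_closure_of_mem_subsemigroupClosure (h ▸ Subsemigroup.mem_top _)
  · rintro ⟨⟨x, hx⟩, h⟩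
    have key : ∀ g : G, g = 1 ∨ g ∈ Subsemigroup.closure X := fun g =>
      Submonoid.eq_one_or_mem_subsemigroupClosure (h ▸ Submonoid.mem_top g)
    have hone : (1 : G) ∈ Subsemigroup.closure X := by
      rcases key x⁻¹ with h1 | h1
      · rw [inv_eq_one] at h1
        exact h1 ▸ Subsemigroup.subset_closure hx
      · simpa using mul_mem (Subsemigroup.subset_closure hx) h1
    refine eq_top_iff.2 fun g _ => ?_
    rcases key g with rfl | hg
    exacts [hone, hg]

theorem FreeGroup.submonoid_eq_top_of_letters {α : Type*} {M : Submonoid (FreeGroup α)}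
    (h : ∀ a : α × Bool, FreeGroup.mk [a] ∈ M) : M = ⊤ := by
  have key : ∀ w : List (α × Bool), FreeGroup.mk w ∈ M := fun w => by
    induction w with
    | nil => exact M.one_mem
    | cons a w ih =>
      rw [← List.singleton_append, ← FreeGroup.mul_mk]
      exact M.mul_mem (h a) ih
  exact eq_top_iff.2 fun g _ => Quot.inductionOn g key

/-! ### The rank of a free group as a semigroup -/

/-- The exponent sums of an element of `F_n`, as a vector. -/
def exponentSum (n : ℕ) : FreeGroup (Fin n) →* Multiplicative (Fin n → ℚ) :=
  FreeGroup.lift fun i => Multiplicative.ofAdd (Pi.single i 1)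

/-- The exponent vectors of a generating set positively span `ℚⁿ`. If there are at most `n` of them
they form a basis, and then the negative of a basis vector is not a nonnegative combination. -/
theorem lt_encard_of_closure_eq_top {n : ℕ} {Y : Set (FreeGroup (Fin n))}
    (hY : Subsemigroup.closure Y = ⊤) : ((n + 1 : ℕ) : ℕ∞) ≤ Y.encard := by
  obtain ⟨⟨y, hy⟩, hM⟩ := subsemigroupClosure_eq_top_iff.1 hY
  by_contra hlt
  have hle : Y.encard ≤ n := by
    rw [not_le] at hlt
    exact Order.le_of_lt_succ (by simpa using hlt)
  have hfin : Y.Finite := Set.finite_of_encard_le_coe hle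
  have := hfin.fintype
  have hcard : Fintype.card Y ≤ n := by
    rw [← Set.coe_fintypeCard] at hle
    exact_mod_cast hle
  let v : Y → (Fin n → ℚ) := fun z => (exponentSum n z).toAdd
  have hmem : ∀ g : FreeGroup (Fin n),
      (exponentSum n g).toAdd ∈ Submodule.span ℚ (Set.range v) := by
    intro g
    have hg : g ∈ Submonoid.closure Y := hM ▸ Submonoid.mem_top g
    induction hg using Submonoid.closure_induction with
    | mem x hx => exact Submodule.subset_span ⟨⟨x, hx⟩, rfl⟩
    | one => simp
    | mul a b _ _ ha hb => simpa using add_mem ha hb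
  have hspan : ⊤ ≤ Submodule.span ℚ (Set.range v) := by
    rw [← (Pi.basisFun ℚ (Fin n)).span_eq, Submodule.span_le]
    rintro _ ⟨i, rfl⟩
    simpa [exponentSum] using hmem (FreeGroup.of i)
  have hcard' : Fintype.card Y = Module.finrank ℚ (Fin n → ℚ) := by
    refine le_antisymm (by simpa using hcard) ?_
    have := finrank_range_le_card (R := ℚ) v
    rwa [Set.finrank, top_le_iff.1 hspan, finrank_top] at this
  have hlin : LinearIndependent ℚ v :=
    linearIndependent_of_top_le_span_of_card_eq_finrank hspan hcard'
  let b := Module.Basis.mk hlin hspan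
  have hb : ∀ z : Y, b.repr (exponentSum n z).toAdd = Finsupp.single z 1 := fun z => by
    rw [← b.repr_self z, Module.Basis.mk_apply]
  have hnonneg : ∀ g : FreeGroup (Fin n), 0 ≤ b.repr (exponentSum n g).toAdd ⟨y, hy⟩ := by
    intro g
    have hg : g ∈ Submonoid.closure Y := hM ▸ Submonoid.mem_top g
    induction hg using Submonoid.closure_induction with
    | mem x hx =>
      rw [hb ⟨x, hx⟩]
      exact Finsupp.single_nonneg.2 zero_le_one _
    | one => simp
    | mul a b _ _ ha hb => simpa using add_nonneg ha hb
  -- The coordinate of `y⁻¹` at the basis vector of `y` is `-1`.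
  have h1 := hnonneg y⁻¹
  rw [map_inv, toAdd_inv, map_neg, hb ⟨y, hy⟩] at h1
  norm_num at h1

/-- `F_n` is generated as a semigroup by the free generators and the inverse of their product. -/
theorem exists_closure_eq_top_encard_le (n : ℕ) :
    ∃ Y : Set (FreeGroup (Fin n)), Subsemigroup.closure Y = ⊤ ∧ Y.encard ≤ (n + 1 : ℕ) := by
  let g : List (Fin n) → FreeGroup (Fin n) := fun s => (s.map FreeGroup.of).prod
  let X : Set (FreeGroup (Fin n)) := Set.range FreeGroup.of
  let Y := insert (g (List.finRange n))⁻¹ X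
  have hof : ∀ i, FreeGroup.of i ∈ Submonoid.closure Y := fun i =>
    Submonoid.subset_closure (Set.mem_insert_of_mem _ ⟨i, rfl⟩)
  have hg : ∀ s, g s ∈ Submonoid.closure Y := fun s =>
    Submonoid.list_prod_mem _ fun x hx => by
      obtain ⟨i, -, rfl⟩ := List.mem_map.1 hx
      exact hof i
  refine ⟨Y, subsemigroupClosure_eq_top_iff.2 ⟨⟨_, Set.mem_insert _ _⟩,
    FreeGroup.submonoid_eq_top_of_letters ?_⟩, ?_⟩
  · rintro ⟨i, _ | _⟩
    · obtain ⟨s, t, hst⟩ := List.append_of_mem (List.mem_finRange i)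
      -- If the product is `u * x * v`, then `x⁻¹ = v * (u * x * v)⁻¹ * u`.
      have hinv : (FreeGroup.of i)⁻¹ = g t * (g (List.finRange n))⁻¹ * g s := by
        simp only [g, hst, List.map_append, List.map_cons, List.prod_append, List.prod_cons]
        group
      change (FreeGroup.of i)⁻¹ ∈ _
      rw [hinv]
      exact mul_mem (mul_mem (hg t) (Submonoid.subset_closure (Set.mem_insert _ _))) (hg s)
    · exact hof i
  · refine (Set.encard_insert_le _ _).trans ?_
    push_cast
    gcongr
    simp only [X, ← Set.image_univ]
    refine (Set.encard_image_le _ _).trans ?_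
    simp

theorem isSemigroupBasis_iff {n : ℕ} {X : Set (FreeGroup (Fin n))} :
    IsSemigroupBasis X ↔ X.encard = (n + 1 : ℕ) ∧ Submonoid.closure X = ⊤ := by
  constructor
  · rintro ⟨h, hmin⟩
    obtain ⟨Y, hY, hcard⟩ := exists_closure_eq_top_encard_le n
    exact ⟨le_antisymm ((hmin Y hY).trans hcard) (lt_encard_of_closure_eq_top h),
      (subsemigroupClosure_eq_top_iff.1 h).2⟩
  · rintro ⟨hcard, h⟩
    refine ⟨subsemigroupClosure_eq_top_iff.2 ⟨?_, h⟩, fun Y hY => ?_⟩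
    · rw [← Set.encard_ne_zero, hcard]
      exact_mod_cast n.succ_ne_zero
    · rw [hcard]
      exact lt_encard_of_closure_eq_top hY

/-! ### Letters in a finitely generated submonoid of a free group -/

section NullPath

variable {α : Type*}

/-- The states of the automaton that reads the words of `l` in a loop: a state is the part of the
current word that is still to be read, and `[]` is both the initial and the final state. -/
def states (l : List (List (α × Bool))) : List (List (α × Bool)) :=
  [] :: l.flatMap List.tails

theorem nil_mem_states (l : List (List (α × Bool))) : [] ∈ states l :=
  List.mem_cons_self

theorem mem_states_of_mem {l : List (List (α × Bool))} {w : List (α × Bool)} (hw : w ∈ l) :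
    w ∈ states l :=
  List.mem_cons_of_mem _ (List.mem_flatMap.2 ⟨w, hw, List.mem_tails _ _ |>.2 List.suffix_rfl⟩)

theorem exists_suffix_of_cons_mem_states {l : List (List (α × Bool))} {a : α × Bool}
    {s : List (α × Bool)} (h : a :: s ∈ states l) : ∃ w ∈ l, a :: s <:+ w := by
  simpa [states] using h

theorem mem_states_of_cons_mem {l : List (List (α × Bool))} {a : α × Bool}
    {s : List (α × Bool)} (h : a :: s ∈ states l) : s ∈ states l := by
  obtain ⟨w, hw, hs⟩ := exists_suffix_of_cons_mem_states h
  exact List.mem_cons_of_mem _ (List.mem_flatMap.2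
    ⟨w, hw, (List.mem_tails _ _).2 ((List.suffix_cons a s).trans hs)⟩)

theorem mem_flatten_of_cons_mem_states {l : List (List (α × Bool))} {a : α × Bool}
    {s : List (α × Bool)} (h : a :: s ∈ states l) : a ∈ l.flatten := by
  obtain ⟨w, hw, hs⟩ := exists_suffix_of_cons_mem_states h
  exact List.mem_flatten.2 ⟨w, hw, hs.subset List.mem_cons_self⟩

/-- The closure conditions of Benois' saturation: `r` is reflexive on states and transitive, it
lets a word of `l` start, and it contains every move that reads a letter, makes an `r`-step, and
reads the inverse letter. -/
structure IsSaturated (l : List (List (α × Bool)))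
    (r : List (α × Bool) → List (α × Bool) → Prop) : Prop where
  refl : ∀ s ∈ states l, r s s
  enter : ∀ w ∈ l, r [] w
  trans : ∀ s ∈ states l, ∀ t ∈ states l, ∀ u ∈ states l, r s t → r t u → r s u
  cancel : ∀ a ∈ l.flatten, ∀ s ∈ states l, ∀ t ∈ states l, a :: s ∈ states l →
    (a.1, !a.2) :: t ∈ states l → r s ((a.1, !a.2) :: t) → r (a :: s) t

/-- The least saturated relation between states: `t` is reached from `s` along a path whose label
is trivial in the free group. -/
inductive NullPath (l : List (List (α × Bool))) : List (α × Bool) → List (α × Bool) → Prop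
  | refl {s} : s ∈ states l → NullPath l s s
  | enter {w} : w ∈ l → NullPath l [] w
  | trans {s t u} : NullPath l s t → NullPath l t u → NullPath l s u
  | cancel {a s t} : a :: s ∈ states l → (a.1, !a.2) :: t ∈ states l →
      NullPath l s ((a.1, !a.2) :: t) → NullPath l (a :: s) t

variable {l : List (List (α × Bool))} {s t u v : List (α × Bool)}

theorem NullPath.mem_states (h : NullPath l s t) : s ∈ states l ∧ t ∈ states l := by
  induction h with
  | refl h => exact ⟨h, h⟩
  | enter h => exact ⟨nil_mem_states l, mem_states_of_mem h⟩
  | trans _ _ h₁ h₂ => exact ⟨h₁.1, h₂.2⟩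
  | cancel h₁ h₂ _ _ => exact ⟨h₁, mem_states_of_cons_mem h₂⟩

theorem isSaturated_nullPath : IsSaturated l (NullPath l) where
  refl _ := .refl
  enter _ := .enter
  trans _ _ _ _ _ _ := .trans
  cancel _ _ _ _ _ _ := .cancel

theorem NullPath.of_isSaturated {r : List (α × Bool) → List (α × Bool) → Prop}
    (hr : IsSaturated l r) (h : NullPath l s t) : r s t := by
  induction h with
  | refl h => exact hr.refl _ h
  | enter h => exact hr.enter _ h
  | trans h₁ h₂ ih₁ ih₂ =>
    exact hr.trans _ h₁.mem_states.1 _ h₁.mem_states.2 _ h₂.mem_states.2 ih₁ ih₂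
  | cancel h₁ h₂ h ih =>
    exact hr.cancel _ (mem_flatten_of_cons_mem_states h₁) _ (mem_states_of_cons_mem h₁) _
      (mem_states_of_cons_mem h₂) h₁ h₂ ih

theorem IsSaturated.congr
    {r r' : List (α × Bool) → List (α × Bool) → Prop} (h : IsSaturated l r)
    (hr : ∀ s ∈ states l, ∀ t ∈ states l, r' s t ↔ r s t) : IsSaturated l r' where
  refl s hs := (hr s hs s hs).2 (h.refl s hs)
  enter w hw := (hr _ (nil_mem_states l) w (mem_states_of_mem hw)).2 (h.enter w hw)
  trans s hs t ht u hu h₁ h₂ := (hr s hs u hu).2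
    (h.trans s hs t ht u hu ((hr s hs t ht).1 h₁) ((hr t ht u hu).1 h₂))
  cancel a ha s hs t ht has hat h₁ := (hr _ has t ht).2
    (h.cancel a ha s hs t ht has hat ((hr s hs _ hat).1 h₁))

/-- The submonoid of the free group generated by the words of `l`. -/
def wordSubmonoid (l : List (List (α × Bool))) : Submonoid (FreeGroup α) :=
  Submonoid.closure {g | ∃ w ∈ l, FreeGroup.mk w = g}

theorem mk_cons (a : α × Bool) (s : List (α × Bool)) :
    FreeGroup.mk (a :: s) = FreeGroup.mk [a] * FreeGroup.mk s := by
  rw [FreeGroup.mul_mk, List.singleton_append]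

theorem mk_singleton_not (a : α × Bool) :
    FreeGroup.mk [(a.1, !a.2)] = (FreeGroup.mk [a])⁻¹ := by
  simp [FreeGroup.inv_mk, FreeGroup.invRev]

/-- Following a path from `s` to `t` finishes the word `s`, reads some words of `l`, and stops with
`t` left to be read; as the label is trivial, `mk s` times these words equals `mk t`. -/
theorem NullPath.inv_mul_mem (h : NullPath l s t) :
    (FreeGroup.mk s)⁻¹ * FreeGroup.mk t ∈ wordSubmonoid l := by
  induction h with
  | refl _ => rw [inv_mul_cancel]; exact one_mem _
  | @enter w h =>
    rw [← FreeGroup.one_eq_mk, inv_one, one_mul]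
    exact Submonoid.subset_closure ⟨w, h, rfl⟩
  | @trans s t u _ _ h₁ h₂ =>
    rw [← mul_inv_cancel_left (FreeGroup.mk t) (FreeGroup.mk u), ← mul_assoc]
    exact mul_mem h₁ h₂
  | @cancel a s t _ _ _ ih =>
    rw [mk_cons (a.1, !a.2) t, mk_singleton_not] at ih
    rw [mk_cons a s, mul_inv_rev, mul_assoc]
    exact ih

/-- `Reads l s u t`: there is a path from `s` to `t` labelled by the word `u` with words that are
trivial in the free group inserted before, between, and after its letters. -/
def Reads (l : List (List (α × Bool))) :
    List (α × Bool) → List (α × Bool) → List (α × Bool) → Prop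
  | s, [], t => NullPath l s t
  | s, a :: u, t => ∃ s', NullPath l s (a :: s') ∧ Reads l s' u t

theorem Reads.nullPath_left {s' : List (α × Bool)} (h : NullPath l s s') (hr : Reads l s' u t) :
    Reads l s u t := by
  cases u with
  | nil => exact h.trans hr
  | cons a u =>
    obtain ⟨q, hq, hr⟩ := hr
    exact ⟨q, h.trans hq, hr⟩

/-- A path can be cut at any point of its label; for an empty part of the label this uses that
`NullPath` is reflexive on states. -/
theorem reads_append : Reads l s (u ++ v) t ↔ ∃ q, Reads l s u q ∧ Reads l q v t := by
  induction u generalizing s with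
  | nil =>
    refine ⟨fun h => ?_, fun ⟨q, hq, h⟩ => h.nullPath_left hq⟩
    refine ⟨s, ?_, h⟩
    cases v with
    | nil => exact .refl (NullPath.mem_states h).1
    | cons a v =>
      obtain ⟨q, hq, -⟩ := h
      exact .refl hq.mem_states.1
  | cons a u ih =>
    simp only [List.cons_append, Reads, ih]
    constructor
    · rintro ⟨p, hp, q, hq, h⟩
      exact ⟨q, ⟨p, hp, hq⟩, h⟩
    · rintro ⟨q, ⟨p, hp, hq⟩, h⟩
      exact ⟨p, hp, q, hq, h⟩

/-- A cancelling pair of letters in the label is absorbed by the closure condition `cancel`. -/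
theorem Reads.of_red (h : FreeGroup.Red u v) (hr : Reads l s u t) : Reads l s v t := by
  induction h with
  | refl => exact hr
  | tail _ hstep ih =>
    cases hstep with
    | @not L₁ L₂ x b =>
      obtain ⟨q, h₁, p, hp, p', hp', h₂⟩ := reads_append.1 ih
      exact reads_append.2 ⟨q, h₁, h₂.nullPath_left
        (hp.trans (.cancel hp.mem_states.2 hp'.mem_states.2 hp'))⟩

theorem reads_self (hs : s ∈ states l) : Reads l s s [] := by
  induction s with
  | nil => exact .refl hs
  | cons a s ih => exact ⟨s, .refl hs, ih (mem_states_of_cons_mem hs)⟩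

theorem reads_flatten {k : List (List (α × Bool))} (hk : ∀ w ∈ k, w ∈ l) :
    Reads l [] k.flatten [] := by
  induction k with
  | nil => exact .refl (nil_mem_states l)
  | cons w k ih =>
    have hw := hk w List.mem_cons_self
    exact reads_append.2 ⟨[], (reads_self (mem_states_of_mem hw)).nullPath_left (.enter hw),
      ih fun w' h => hk w' (List.mem_cons_of_mem _ h)⟩

theorem exists_flatten_of_mem_wordSubmonoid {g : FreeGroup α} (hg : g ∈ wordSubmonoid l) :
    ∃ k : List (List (α × Bool)), (∀ w ∈ k, w ∈ l) ∧ FreeGroup.mk k.flatten = g := by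
  induction hg using Submonoid.closure_induction with
  | mem x hx =>
    obtain ⟨w, hw, rfl⟩ := hx
    exact ⟨[w], by simpa using hw, by simp⟩
  | one => exact ⟨[], by simp, rfl⟩
  | mul x y _ _ hx hy =>
    obtain ⟨k, hk, rfl⟩ := hx
    obtain ⟨k', hk', rfl⟩ := hy
    refine ⟨k ++ k', fun w hw => ?_, by rw [List.flatten_append, FreeGroup.mul_mk]⟩
    rcases List.mem_append.1 hw with h | h
    exacts [hk w h, hk' w h]

/-- Membership of a letter is visible in the least saturated relation: a product of words of `l`
equal to the letter `a` in the free group reduces to the one-letter word `[a]`, and reduction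
preserves `Reads`. -/
theorem mk_singleton_mem_iff (a : α × Bool) :
    FreeGroup.mk [a] ∈ wordSubmonoid l ↔
      ∃ s ∈ states l, a :: s ∈ states l ∧ NullPath l [] (a :: s) ∧ NullPath l s [] := by
  constructor
  · intro h
    obtain ⟨k, hk, hka⟩ := exists_flatten_of_mem_wordSubmonoid h
    have hred : FreeGroup.Red k.flatten [a] := by
      classical
      have h1 := FreeGroup.reduce.sound hka
      rw [FreeGroup.reduce_singleton] at h1
      exact h1 ▸ FreeGroup.reduce.red
    obtain ⟨s, h₁, h₂⟩ := (reads_flatten hk).of_red hred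
    exact ⟨s, NullPath.mem_states h₂ |>.1, h₁.mem_states.2, h₁, h₂⟩
  · rintro ⟨s, -, -, h₁, h₂⟩
    have := mul_mem h₁.inv_mul_mem h₂.inv_mul_mem
    rwa [mk_cons a s, ← FreeGroup.one_eq_mk, inv_one, one_mul, mul_one,
      mul_inv_cancel_right] at this

end NullPath

/-! ### Deciding membership of a letter -/

section Code

variable {α : Type*} [DecidableEq α]

/-- All pairs of states, in the order that gives them their numbers in `codedRel`. -/
def statePairs (l : List (List (α × Bool))) : List (List (α × Bool) × List (α × Bool)) :=
  (states l).flatMap fun s => (states l).map fun t => (s, t)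

/-- The relation on states coded by the binary expansion of `c`: a pair is related if the bit of `c`
at its first position in `statePairs l` is `1`. -/
def codedRel (l : List (List (α × Bool))) (c : ℕ) (s t : List (α × Bool)) : Prop :=
  c / 2 ^ (statePairs l).idxOf (s, t) % 2 = 1

theorem exists_codedRel_iff (l : List (List (α × Bool)))
    (r : List (α × Bool) → List (α × Bool) → Prop) :
    ∃ c < 2 ^ (statePairs l).length, ∀ s ∈ states l, ∀ t ∈ states l, codedRel l c s t ↔ r s t := by
  classical
  let f : Fin (statePairs l).length → Bool := fun i => r ((statePairs l)[i]).1 ((statePairs l)[i]).2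
  refine ⟨Nat.ofBits f, Nat.ofBits_lt_two_pow f, fun s hs t ht => ?_⟩
  have hmem : (s, t) ∈ statePairs l :=
    List.mem_flatMap.2 ⟨s, hs, List.mem_map.2 ⟨t, ht, rfl⟩⟩
  have h := Nat.testBit_ofBits_lt f _ (List.idxOf_lt_length_of_mem hmem)
  rw [Nat.testBit_eq_decide_div_mod_eq] at h
  rw [codedRel, ← decide_eq_true_iff (p := _ = 1), h]
  simp [f]

/-- Membership of a letter as a formula with bounded quantifiers only: the least saturated relation
is replaced by all the saturated relations on the finite set of states. -/
theorem mk_singleton_mem_iff_forall_code {l : List (List (α × Bool))} (a : α × Bool) :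
    FreeGroup.mk [a] ∈ wordSubmonoid l ↔
      ∀ c < 2 ^ (statePairs l).length, IsSaturated l (codedRel l c) →
        ∃ s ∈ states l, a :: s ∈ states l ∧ codedRel l c [] (a :: s) ∧ codedRel l c s [] := by
  rw [mk_singleton_mem_iff]
  constructor
  · rintro ⟨s, hs, has, h₁, h₂⟩ c - hc
    exact ⟨s, hs, has, h₁.of_isSaturated hc, h₂.of_isSaturated hc⟩
  · intro h
    obtain ⟨c, hlt, hc⟩ := exists_codedRel_iff l (NullPath l)
    obtain ⟨s, hs, has, h₁, h₂⟩ := h c hlt (isSaturated_nullPath.congr hc)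
    exact ⟨s, hs, has, (hc _ (nil_mem_states l) _ has).1 h₁, (hc s hs _ (nil_mem_states l)).1 h₂⟩

end Code

/-! ### Primitive recursiveness -/

section Primrec

variable {α β γ : Type*} [Primcodable α] [Primcodable β] [Primcodable γ]

theorem PrimrecPred.imp {p q : α → Prop} (hp : PrimrecPred p) (hq : PrimrecPred q) :
    PrimrecPred fun x => p x → q x :=
  (hp.not.or hq).of_eq fun _ => imp_iff_not_or.symm

theorem PrimrecPred.ballList {f : β → List α} (hf : Primrec f) {R : β → α → Prop}
    (hR : PrimrecPred fun x : β × α => R x.1 x.2) : PrimrecPred fun b => ∀ a ∈ f b, R b a :=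
  PrimrecRel.comp (PrimrecRel.forall_mem_list
    (R := fun a b => R b a) (hR.comp (Primrec.pair Primrec.snd Primrec.fst))) hf Primrec.id

theorem PrimrecPred.bexList {f : β → List α} (hf : Primrec f) {R : β → α → Prop}
    (hR : PrimrecPred fun x : β × α => R x.1 x.2) : PrimrecPred fun b => ∃ a ∈ f b, R b a :=
  PrimrecRel.comp (PrimrecRel.exists_mem_list
    (R := fun a b => R b a) (hR.comp (Primrec.pair Primrec.snd Primrec.fst))) hf Primrec.id

theorem PrimrecPred.ballLT {f : β → ℕ} (hf : Primrec f) {R : β → ℕ → Prop}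
    (hR : PrimrecPred fun x : β × ℕ => R x.1 x.2) : PrimrecPred fun b => ∀ i < f b, R b i :=
  (PrimrecPred.ballList (Primrec.list_range.comp hf) hR).of_eq fun b => by
    simp only [List.mem_range]

theorem PrimrecPred.memList {f : β → α} {g : β → List α} (hf : Primrec f) (hg : Primrec g) :
    PrimrecPred fun b => f b ∈ g b := by
  classical
  exact (PrimrecPred.bexList (R := fun b a => a = f b) hg
    (Primrec.eq.comp Primrec.snd (hf.comp Primrec.fst))).of_eq fun b => by simp

theorem Primrec.list_tails : Primrec (List.tails : List α → List (List α)) := by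
  refine (Primrec.list_rec (f := id) (g := fun _ => [[]])
    (h := fun _ (x : α × List α × List (List α)) => (x.1 :: x.2.1) :: x.2.2) Primrec.id
    (Primrec.const _) ?_).of_eq fun w => ?_
  · exact Primrec.list_cons.comp
      (Primrec.list_cons.comp (Primrec.fst.comp Primrec.snd)
        (Primrec.fst.comp (Primrec.snd.comp Primrec.snd)))
      (Primrec.snd.comp (Primrec.snd.comp Primrec.snd))
  · induction w with
    | nil => rfl
    | cons a w ih => simpa using ih

theorem Primrec.list_dedup [DecidableEq α] : Primrec (List.dedup : List α → List α) := by
  refine (Primrec.list_foldr (f := id) (g := fun _ => [])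
    (h := fun _ (x : α × List α) => if x.1 ∈ x.2 then x.2 else x.1 :: x.2) Primrec.id
    (Primrec.const _) ?_).of_eq fun w => ?_
  · exact Primrec.ite
      (PrimrecPred.memList (Primrec.fst.comp Primrec.snd) (Primrec.snd.comp Primrec.snd))
      (Primrec.snd.comp Primrec.snd)
      (Primrec.list_cons.comp (Primrec.fst.comp Primrec.snd) (Primrec.snd.comp Primrec.snd))
  · induction w with
    | nil => rfl
    | cons a w ih =>
      simp only [id, List.foldr_cons] at ih ⊢
      rw [ih]
      by_cases h : a ∈ w
      · simp [h]
      · simp [h]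

theorem Primrec.freeGroup_reduce [DecidableEq α] :
    Primrec (FreeGroup.reduce : List (α × Bool) → List (α × Bool)) := by
  refine (Primrec.list_foldr (f := id) (g := fun _ => [])
    (h := fun _ (x : (α × Bool) × List (α × Bool)) =>
      List.casesOn x.2 [x.1] fun y t =>
        if x.1.1 = y.1 ∧ x.1.2 = !y.2 then t else x.1 :: y :: t) Primrec.id
    (Primrec.const _) ?_).of_eq fun w => ?_
  · refine Primrec.list_casesOn
      (f := fun x : List (α × Bool) × (α × Bool) × List (α × Bool) => x.2.2)
      (g := fun x => [x.2.1])
      (h := fun x (z : (α × Bool) × List (α × Bool)) =>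
        if x.2.1.1 = z.1.1 ∧ x.2.1.2 = !z.1.2 then z.2 else x.2.1 :: z.1 :: z.2)
      (Primrec.snd.comp Primrec.snd)
      (Primrec.list_cons.comp (Primrec.fst.comp Primrec.snd) (Primrec.const [])) ?_
    have hx : Primrec fun p : (List (α × Bool) × (α × Bool) × List (α × Bool)) ×
        (α × Bool) × List (α × Bool) => p.1.2.1 :=
      Primrec.fst.comp (Primrec.snd.comp Primrec.fst)
    have hy : Primrec fun p : (List (α × Bool) × (α × Bool) × List (α × Bool)) ×
        (α × Bool) × List (α × Bool) => p.2.1 :=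
      Primrec.fst.comp Primrec.snd
    exact Primrec.ite
      ((Primrec.eq.comp (Primrec.fst.comp hx) (Primrec.fst.comp hy)).and
        (Primrec.eq.comp (Primrec.snd.comp hx) (Primrec.not.comp (Primrec.snd.comp hy))))
      (Primrec.snd.comp Primrec.snd)
      (Primrec.list_cons.comp hx (Primrec.list_cons.comp hy (Primrec.snd.comp Primrec.snd)))
  · induction w with
    | nil => rfl
    | cons a w ih =>
      simp only [id, List.foldr_cons] at ih ⊢
      rw [ih, FreeGroup.reduce.cons]

theorem primrec_states : Primrec (states : List (List (α × Bool)) → List (List (α × Bool))) :=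
  Primrec.list_cons.comp (Primrec.const [])
    (Primrec.list_flatMap Primrec.id (Primrec.list_tails.comp Primrec.snd))

theorem primrec_statePairs : Primrec (statePairs (α := α)) :=
  Primrec.list_flatMap primrec_states <| Primrec.list_map (primrec_states.comp Primrec.fst) <|
    Primrec.pair (Primrec.snd.comp Primrec.fst) Primrec.snd

theorem primrec_two_pow {f : β → ℕ} (hf : Primrec f) : Primrec fun b => 2 ^ f b :=
  (Primrec₂.unpaired'.1 Nat.Primrec.pow).comp (Primrec.const 2) hf

variable [DecidableEq α]

/-- The version of `Primrec.list_idxOf` for an arbitrary lawful equality test, such as the one on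
pairs, which is not the one derived from decidable equality. -/
theorem Primrec.list_idxOf_of_lawfulBEq [inst : BEq γ] [LawfulBEq γ] :
    Primrec₂ (@List.idxOf γ _) := by
  classical
  rw [show inst = instBEqOfDecidableEq from lawful_beq_subsingleton _ _]
  exact Primrec.list_idxOf

theorem primrecPred_codedRel {l : β → List (List (α × Bool))} {c : β → ℕ}
    {s t : β → List (α × Bool)} (hl : Primrec l) (hc : Primrec c) (hs : Primrec s)
    (ht : Primrec t) : PrimrecPred fun b => codedRel (l b) (c b) (s b) (t b) :=
  Primrec.eq.comp
    (Primrec.nat_mod.comp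
      (Primrec.nat_div.comp hc (primrec_two_pow
        (Primrec.list_idxOf_of_lawfulBEq.comp (Primrec.pair hs ht) (primrec_statePairs.comp hl))))
      (Primrec.const 2))
    (Primrec.const 1)

theorem primrecPred_isSaturated {l : β → List (List (α × Bool))} {c : β → ℕ} (hl : Primrec l)
    (hc : Primrec c) : PrimrecPred fun b => IsSaturated (l b) (codedRel (l b) (c b)) := by
  have hQ : Primrec fun b => states (l b) := primrec_states.comp hl
  have h₁ : PrimrecPred fun b => ∀ s ∈ states (l b), codedRel (l b) (c b) s s :=
    .ballList hQ <| primrecPred_codedRel (hl.comp .fst) (hc.comp .fst) .snd .snd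
  have h₂ : PrimrecPred fun b => ∀ w ∈ l b, codedRel (l b) (c b) [] w :=
    .ballList hl <| primrecPred_codedRel (hl.comp .fst) (hc.comp .fst) (.const _) .snd
  have h₃ : PrimrecPred fun b => ∀ s ∈ states (l b), ∀ t ∈ states (l b), ∀ u ∈ states (l b),
      codedRel (l b) (c b) s t → codedRel (l b) (c b) t u → codedRel (l b) (c b) s u := by
    refine .ballList hQ <| .ballList (hQ.comp .fst) <| .ballList (hQ.comp (.comp .fst .fst)) ?_
    have hb : Primrec fun x : ((β × List (α × Bool)) × List (α × Bool)) × List (α × Bool) =>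
      x.1.1.1 := .comp .fst (.comp .fst .fst)
    have hs : Primrec fun x : ((β × List (α × Bool)) × List (α × Bool)) × List (α × Bool) =>
      x.1.1.2 := .comp .snd (.comp .fst .fst)
    have ht : Primrec fun x : ((β × List (α × Bool)) × List (α × Bool)) × List (α × Bool) =>
      x.1.2 := .comp .snd .fst
    exact .imp (primrecPred_codedRel (hl.comp hb) (hc.comp hb) hs ht) <|
      .imp (primrecPred_codedRel (hl.comp hb) (hc.comp hb) ht .snd)
        (primrecPred_codedRel (hl.comp hb) (hc.comp hb) hs .snd)
  have h₄ : PrimrecPred fun b => ∀ a ∈ (l b).flatten, ∀ s ∈ states (l b), ∀ t ∈ states (l b),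
      a :: s ∈ states (l b) → (a.1, !a.2) :: t ∈ states (l b) →
      codedRel (l b) (c b) s ((a.1, !a.2) :: t) → codedRel (l b) (c b) (a :: s) t := by
    refine .ballList (Primrec.list_flatten.comp hl) <| .ballList (hQ.comp .fst) <|
      .ballList (hQ.comp (.comp .fst .fst)) ?_
    have hb : Primrec fun x : ((β × (α × Bool)) × List (α × Bool)) × List (α × Bool) =>
      x.1.1.1 := .comp .fst (.comp .fst .fst)
    have ha : Primrec fun x : ((β × (α × Bool)) × List (α × Bool)) × List (α × Bool) =>
      x.1.1.2 := .comp .snd (.comp .fst .fst)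
    have hs : Primrec fun x : ((β × (α × Bool)) × List (α × Bool)) × List (α × Bool) =>
      x.1.2 := .comp .snd .fst
    have has := Primrec.list_cons.comp ha hs
    have hat := Primrec.list_cons.comp
      (Primrec.pair (Primrec.fst.comp ha) (Primrec.not.comp (Primrec.snd.comp ha)))
      (Primrec.snd (α := (β × (α × Bool)) × List (α × Bool)) (β := List (α × Bool)))
    exact .imp (.memList has (hQ.comp hb)) <| .imp (.memList hat (hQ.comp hb)) <|
      .imp (primrecPred_codedRel (hl.comp hb) (hc.comp hb) hs hat)
        (primrecPred_codedRel (hl.comp hb) (hc.comp hb) has .snd)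
  exact (h₁.and (h₂.and (h₃.and h₄))).of_eq fun b =>
    ⟨fun ⟨h₁, h₂, h₃, h₄⟩ => ⟨h₁, h₂, h₃, h₄⟩, fun ⟨h₁, h₂, h₃, h₄⟩ => ⟨h₁, h₂, h₃, h₄⟩⟩

theorem primrecPred_mk_singleton_mem {l : β → List (List (α × Bool))} {a : β → α × Bool}
    (hl : Primrec l) (ha : Primrec a) :
    PrimrecPred fun b => FreeGroup.mk [a b] ∈ wordSubmonoid (l b) := by
  have hQ : Primrec fun b => states (l b) := primrec_states.comp hl
  have h : PrimrecPred fun b => ∀ c < 2 ^ (statePairs (l b)).length,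
      IsSaturated (l b) (codedRel (l b) c) →
        ∃ s ∈ states (l b), a b :: s ∈ states (l b) ∧
          codedRel (l b) c [] (a b :: s) ∧ codedRel (l b) c s [] := by
    refine .ballLT (primrec_two_pow (Primrec.list_length.comp (primrec_statePairs.comp hl))) <|
      .imp (primrecPred_isSaturated (hl.comp .fst) .snd) <| .bexList (hQ.comp .fst) ?_
    have hb : Primrec fun x : (β × ℕ) × List (α × Bool) => x.1.1 := .comp .fst .fst
    have hc : Primrec fun x : (β × ℕ) × List (α × Bool) => x.1.2 := .comp .snd .fst
    have has := Primrec.list_cons.comp (ha.comp hb)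
      (Primrec.snd (α := β × ℕ) (β := List (α × Bool)))
    exact .and (.memList has (hQ.comp hb)) <|
      .and (primrecPred_codedRel (hl.comp hb) hc (.const _) has)
        (primrecPred_codedRel (hl.comp hb) hc .snd (.const _))
  exact h.of_eq fun b => (mk_singleton_mem_iff_forall_code (a b)).symm

end Primrec

/-! ### The algorithm -/

/-- Distinct elements correspond to distinct reduced words, so they can be counted. -/
theorem encard_setOf_mk {α : Type*} [DecidableEq α] (l : List (List (α × Bool))) :
    {g : FreeGroup α | ∃ w ∈ l, FreeGroup.mk w = g}.encard =
      ((l.map FreeGroup.reduce).dedup.length : ℕ∞) := by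
  have himg : FreeGroup.toWord '' {g : FreeGroup α | ∃ w ∈ l, FreeGroup.mk w = g} =
      ((l.map FreeGroup.reduce).toFinset : Set (List (α × Bool))) := by
    ext w
    simp [FreeGroup.toWord_mk]
  rw [← FreeGroup.toWord_injective.encard_image, himg, Set.encard_coe_eq_coe_finsetCard,
    List.card_toFinset]

theorem map_val_finiteSubsetOf {n : ℕ} (L : List (List (Fin n × Bool))) :
    FreeGroup.map Fin.val '' finiteSubsetOf L =
      {g : FreeGroup ℕ | ∃ w ∈ inputOf L, FreeGroup.mk w = g} := by
  ext g
  simp [finiteSubsetOf, inputOf, FreeGroup.map.mk]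

theorem exists_inputOf_eq_iff {n : ℕ} {l : List (List (ℕ × Bool))} :
    (∃ L : List (List (Fin n × Bool)), inputOf L = l) ↔ ∀ w ∈ l, ∀ x ∈ w, x.1 < n := by
  constructor
  · rintro ⟨L, rfl⟩ w hw x hx
    obtain ⟨w, -, rfl⟩ := List.mem_map.1 hw
    obtain ⟨x, -, rfl⟩ := List.mem_map.1 hx
    exact x.1.2
  · intro h
    refine ⟨l.attach.map fun w => w.1.attach.map fun x => (⟨x.1.1, h w.1 w.2 x.1 x.2⟩, x.1.2), ?_⟩
    simp only [inputOf, List.map_map, Function.comp_def, Prod.mk.eta, List.attach_map_subtype_val]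

/-- `F_n` embeds into the free group on all natural numbers, so that the condition can be checked
there, uniformly in `n`. -/
theorem isSemigroupBasis_finiteSubsetOf_iff {n : ℕ} (L : List (List (Fin n × Bool))) :
    IsSemigroupBasis (finiteSubsetOf L) ↔
      (((inputOf L).map FreeGroup.reduce).dedup.length = n + 1 ∧
        ∀ i < n, FreeGroup.mk [(i, true)] ∈ wordSubmonoid (inputOf L) ∧
          FreeGroup.mk [(i, false)] ∈ wordSubmonoid (inputOf L)) := by
  have hinj : Function.Injective (FreeGroup.map (Fin.val : Fin n → ℕ)) :=
    FreeGroup.map_injective Fin.val_injective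
  have hmem : ∀ a : Fin n × Bool, FreeGroup.mk [a] ∈ Submonoid.closure (finiteSubsetOf L) ↔
      FreeGroup.mk [((a.1 : ℕ), a.2)] ∈ wordSubmonoid (inputOf L) := by
    intro a
    rw [wordSubmonoid, ← map_val_finiteSubsetOf, ← MonoidHom.map_mclosure,
      ← Submonoid.mem_map_iff_mem hinj, FreeGroup.map.mk, List.map_singleton]
  rw [isSemigroupBasis_iff, ← hinj.encard_image, map_val_finiteSubsetOf, encard_setOf_mk,
    Nat.cast_inj]
  refine and_congr_right fun _ => ⟨fun h i hi => ?_, fun h => ?_⟩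
  · exact ⟨(hmem (⟨i, hi⟩, true)).1 (h ▸ Submonoid.mem_top _),
      (hmem (⟨i, hi⟩, false)).1 (h ▸ Submonoid.mem_top _)⟩
  · refine FreeGroup.submonoid_eq_top_of_letters fun ⟨i, b⟩ => (hmem (i, b)).2 ?_
    cases b
    exacts [(h i i.2).2, (h i i.2).1]

/-- The inputs are pairs `(n, l)` of a natural number and a list of words; the algorithm accepts
exactly those for which `l` lists words over the generators of `F_n` and their inverses, and the
set of elements of `F_n` represented by these words is a semigroup basis of `F_n`. -/
theorem mainTheorem8 :
    ComputablePred fun p : ℕ × List (List (ℕ × Bool)) =>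
      ∃ L : List (List (Fin p.1 × Bool)),
        inputOf L = p.2 ∧ IsSemigroupBasis (finiteSubsetOf L) := by
  refine PrimrecPred.computablePred ?_
  have h₁ : PrimrecPred fun p : ℕ × List (List (ℕ × Bool)) => ∀ w ∈ p.2, ∀ x ∈ w, x.1 < p.1 :=
    .ballList .snd <| .ballList .snd <|
      Primrec.nat_lt.comp (.comp .fst .snd) (.comp .fst (.comp .fst .fst))
  have h₂ : PrimrecPred fun p : ℕ × List (List (ℕ × Bool)) =>
      (p.2.map FreeGroup.reduce).dedup.length = p.1 + 1 :=
    Primrec.eq.comp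
      (Primrec.list_length.comp (Primrec.list_dedup.comp
        (Primrec.list_map .snd (Primrec.freeGroup_reduce.comp .snd))))
      (Primrec.succ.comp .fst)
  have h₃ : PrimrecPred fun p : ℕ × List (List (ℕ × Bool)) =>
      ∀ i < p.1, FreeGroup.mk [(i, true)] ∈ wordSubmonoid p.2 ∧
        FreeGroup.mk [(i, false)] ∈ wordSubmonoid p.2 :=
    .ballLT .fst <| .and
      (primrecPred_mk_singleton_mem (.comp .snd .fst) (.pair .snd (.const _)))
      (primrecPred_mk_singleton_mem (.comp .snd .fst) (.pair .snd (.const _)))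
  refine (h₁.and (h₂.and h₃)).of_eq fun ⟨n, l⟩ => ?_
  dsimp only
  constructor
  · rintro ⟨hl, h⟩
    obtain ⟨L, rfl⟩ := exists_inputOf_eq_iff.2 hl
    exact ⟨L, rfl, (isSemigroupBasis_finiteSubsetOf_iff L).2 h⟩
  · rintro ⟨L, rfl, h⟩
    exact ⟨exists_inputOf_eq_iff.1 ⟨L, rfl⟩, (isSemigroupBasis_finiteSubsetOf_iff L).1 h⟩
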